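/- For each $n\ge 0$, the $n$-bit quantum--quantum comparator is the unitary on $2n+1$ qubits (two $n$-qubit registers and one target qubit) defined on computational basis states by $$|a\rangle|b\rangle|z\rangle\;\mapsto\;|a\rangle|b\rangle|z\oplus(a<b)\rangle,\qquad a,b\in\{0,1\}^n,\ z\in\{0,1\},$$ where $(a<b)\in\{0,1\}$ is $1$ if and only if the integer with binary representation $a$ is smaller than the one with binary representation $b$. There is a family of quantum circuits $(\mathcal C_n)_{n\ge 0}$ such that, for every $n$, $\mathcal C_n$ acts on exactly these $2n+1$ qubits (no ancilla qubits), consists only of $CCX$ (Toffoli), $CX$ (CNOT) and $X$ (NOT) gates, and implements the $n$-bit quantum--quantum comparator exactly; and, as $n\to\infty$, the number of gates of $\mathcal C_n$ is $\Theta(n)$ and its circuit depth (the number of time steps when gates on disjoint sets of qubits are executed in parallel) is $\Theta(\log n)$. -/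

import Mathlib

open scoped Asymptotics

/-- A gate of the set `{CCX, CX, X}` placed on distinct qubits of a register `Q`;
the last qubit is the target, the others are the controls. -/
inductive Gate (Q : Type*) where
  | X (t : Q)
  | CX (c t : Q) (h : c ≠ t)
  | CCX (c₁ c₂ t : Q) (h₁₂ : c₁ ≠ c₂) (h₁ : c₁ ≠ t) (h₂ : c₂ ≠ t)

namespace Gate

variable {Q : Type*} [DecidableEq Q]

/-- The qubits on which a gate acts. -/
def support : Gate Q → Finset Q
  | X t => {t}
  | CX c t _ => {c, t}
  | CCX c₁ c₂ t _ _ _ => {c₁, c₂, t}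

/-- The action of a gate on the labels of the computational basis states:
the target bit is flipped exactly when all the control bits are `1`. -/
def act : Gate Q → (Q → Bool) → (Q → Bool)
  | X t, x => Function.update x t (!(x t))
  | CX c t _, x => Function.update x t (xor (x t) (x c))
  | CCX c₁ c₂ t _ _ _, x => Function.update x t (xor (x t) (x c₁ && x c₂))

theorem act_involutive (g : Gate Q) : Function.Involutive g.act := by
  intro x
  cases g with
  | X t => simp [act]
  | CX c t h => simp [act, h]
  | CCX c₁ c₂ t h₁₂ h₁ h₂ => simp [act, h₁, h₂]

end Gate

/-- The state space `(ℂ²)^{⊗ Q}` of a register `Q`, with the computational basis indexed by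
the bit assignments `Q → Bool`. -/
abbrev QState (Q : Type*) [Fintype Q] := EuclideanSpace ℂ (Q → Bool)

/-- The computational basis state `|x⟩`. -/
noncomputable def ket {Q : Type*} [Fintype Q] [DecidableEq Q] (x : Q → Bool) : QState Q :=
  EuclideanSpace.single x 1

/-- The unitary operator of a gate: the one with `|x⟩ ↦ |g.act x⟩` for every bit assignment `x`. -/
noncomputable def Gate.unitary {Q : Type*} [Fintype Q] [DecidableEq Q] (g : Gate Q) :
    QState Q ≃ₗᵢ[ℂ] QState Q :=
  LinearIsometryEquiv.piLpCongrLeft 2 ℂ ℂ g.act_involutive.toPerm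

theorem Gate.unitary_ket {Q : Type*} [Fintype Q] [DecidableEq Q] (g : Gate Q) (x : Q → Bool) :
    g.unitary (ket x) = ket (g.act x) := by
  simp [Gate.unitary, ket]

/-- A circuit over `{CCX, CX, X}` on the register `Q` and on no other qubit:
the sequence of its gates, the first one being applied first. -/
abbrev Circuit (Q : Type*) := List (Gate Q)

namespace Circuit

variable {Q : Type*} [Fintype Q] [DecidableEq Q]

/-- The unitary operator that a circuit implements: the product of those of its gates. -/
noncomputable def unitary : Circuit Q → (QState Q ≃ₗᵢ[ℂ] QState Q)
  | [] => LinearIsometryEquiv.refl ℂ (QState Q)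
  | g :: C => g.unitary.trans (unitary C)

/-- The number of gates of a circuit. -/
def gateCount (C : Circuit Q) : ℕ := C.length

/-- For each qubit, the number of time steps after which the last gate on it is done, when every
gate takes one time step and starts as soon as all earlier gates on its qubits are done. -/
def finishTime (C : Circuit Q) : Q → ℕ :=
  C.foldl (fun τ g q => if q ∈ g.support then g.support.sup τ + 1 else τ q) (fun _ => 0)

/-- The depth of a circuit: the number of time steps it takes when gates on disjoint sets of
qubits are executed in parallel, that is, the largest number of gates on a path through it. -/
def depth (C : Circuit Q) : ℕ := Finset.univ.sup (finishTime C)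

end Circuit

/-- The `2n + 1` qubits of the `n`-bit comparator: two `n`-qubit registers and one target qubit. -/
abbrev ComparatorQubit (n : ℕ) := Fin n ⊕ Fin n ⊕ Unit

/-- The basis state `|a⟩|b⟩|z⟩`. -/
noncomputable def ket₃ {n : ℕ} (a b : Fin n → Bool) (z : Bool) : QState (ComparatorQubit n) :=
  ket (Sum.elim a (Sum.elim b (fun _ => z)))

/-- The natural number with binary digits `a`, the digit `a 0` being the least significant. -/
def bitsValue {n : ℕ} (a : Fin n → Bool) : ℕ := ∑ i, (a i).toNat * 2 ^ (i : ℕ)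

/-- `U` is the `n`-bit comparison operator `|a⟩|b⟩|z⟩ ↦ |a⟩|b⟩|z ⊕ (a < b)⟩`. -/
def IsComparator {n : ℕ}
    (U : QState (ComparatorQubit n) ≃ₗᵢ[ℂ] QState (ComparatorQubit n)) : Prop :=
  ∀ (a b : Fin n → Bool) (z : Bool),
    U (ket₃ a b z) = ket₃ a b (xor z (decide (bitsValue a < bitsValue b)))

/-! The bits are compared through digits `(e, v)`: `e` says whether `aᵢ = bᵢ`, and `v = bᵢ` decides
when `e = 0`. So `a < b` is the value `v` of the most significant digit with `e = 0`, and `0` if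
there is none. Two adjacent digits merge into one with a constant number of gates, but the
conjunction of their flags needs a qubit in state `0`, and a tree of merges needs linearly many.

No ancilla is required because clean qubits are needed only conditionally. If the merged digits are
equal, their flags are `1`, and flipping them gives two clean qubits. If not, the outcome is already
settled, and whatever less significant merges do on dirty qubits is ignored. One clean qubit thus
bootstraps the process: a round merges two digits to renew its seed and a block of `2 ^ k` digits in
a tree, and the qubits it releases serve a block of `2 ^ (k + 1)` (`foldBlock_card`). Rounds are
pipelined, one level apart, so `m` of them take `O(m)` steps (`release_foldBlocks`), and a
sequential `ladder` finishes the at most `2 * m` remaining digits. The first clean qubit is the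
flipped flag of the top digit, on the same condition; `act_addOutcome` cancels the garbage produced
when that condition fails. Conjugation restores all the other qubits.

For the lower bounds, the target depends on all `n` bits of the first register, while a light cone
of depth `d` has at most `3 ^ d` qubits, and linearly many in the number of gates
(`exists_lightCone`). -/

/-! ### Gates and circuits as maps of bit assignments. -/

namespace Gate

variable {Q : Type*} [DecidableEq Q]

theorem act_of_notMem_support (g : Gate Q) (x : Q → Bool) {q : Q} (hq : q ∉ g.support) :
    g.act x q = x q := by
  cases g <;> simp_all [support, act]

theorem act_update_of_notMem_support (g : Gate Q) (x : Q → Bool) (v : Bool) {q : Q}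
    (hq : q ∉ g.support) : g.act (Function.update x q v) = Function.update (g.act x) q v := by
  cases g <;> simp only [support, Finset.mem_insert, Finset.mem_singleton, not_or] at hq
  · rw [act, act, Function.update_comm (Ne.symm hq), Function.update_of_ne (Ne.symm hq)]
  · rw [act, act, Function.update_comm (Ne.symm hq.2), Function.update_of_ne (Ne.symm hq.1),
      Function.update_of_ne (Ne.symm hq.2)]
  · rw [act, act, Function.update_comm (Ne.symm hq.2.2), Function.update_of_ne (Ne.symm hq.1),
      Function.update_of_ne (Ne.symm hq.2.1), Function.update_of_ne (Ne.symm hq.2.2)]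

/-- A gate acts on the values of the qubits in its support, as a function of these values. -/
theorem act_congr (g : Gate Q) {x y : Q → Bool} (h : ∀ q ∈ g.support, x q = y q) {q : Q}
    (hq : q ∈ g.support) : g.act x q = g.act y q := by
  have hxy := h q hq
  cases g <;> simp only [support, Finset.mem_insert, Finset.mem_singleton, forall_eq_or_imp,
    forall_eq] at h <;> simp only [act, Function.update_apply, hxy, h]

theorem card_support_le (g : Gate Q) : g.support.card ≤ 3 := by
  cases g
  · simp [support]
  · exact Finset.card_le_two.trans (by norm_num)
  · exact Finset.card_le_three

end Gate

namespace Circuit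

variable {Q : Type*} [DecidableEq Q]

/-- The action of a circuit on the labels of the computational basis states. -/
def act (C : Circuit Q) (x : Q → Bool) : Q → Bool := C.foldl (fun x g => g.act x) x

@[simp] theorem act_nil (x : Q → Bool) : act [] x = x := rfl

@[simp] theorem act_cons (g : Gate Q) (C : Circuit Q) (x : Q → Bool) :
    act (g :: C) x = act C (g.act x) := rfl

@[simp] theorem act_append (C D : Circuit Q) (x : Q → Bool) :
    act (C ++ D) x = act D (act C x) := List.foldl_append

theorem act_reverse_act (C : Circuit Q) (x : Q → Bool) : act C.reverse (act C x) = x := by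
  induction C generalizing x with
  | nil => rfl
  | cons g C ih => simp [ih, g.act_involutive x]

theorem unitary_ket [Fintype Q] (C : Circuit Q) (x : Q → Bool) :
    unitary C (ket x) = ket (act C x) := by
  induction C generalizing x with
  | nil => rfl
  | cons g C ih => simp [unitary, ih, Gate.unitary_ket]

/-- All the gates of the circuit `C` act on qubits of `S` only. -/
def SupportedOn (C : Circuit Q) (S : Set Q) : Prop := ∀ g ∈ C, ∀ q ∈ g.support, q ∈ S

section SupportedOn

variable {C D : Circuit Q} {S T : Set Q}

@[simp] theorem supportedOn_nil : SupportedOn ([] : Circuit Q) S := by simp [SupportedOn]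

@[simp] theorem supportedOn_cons {g : Gate Q} :
    SupportedOn (g :: C) S ↔ (∀ q ∈ g.support, q ∈ S) ∧ SupportedOn C S := by
  simp [SupportedOn]

@[simp] theorem supportedOn_append :
    SupportedOn (C ++ D) S ↔ SupportedOn C S ∧ SupportedOn D S := by
  simp [SupportedOn, or_imp, forall_and]

theorem supportedOn_reverse : SupportedOn C.reverse S ↔ SupportedOn C S := by
  simp [SupportedOn]

theorem SupportedOn.mono (h : SupportedOn C S) (hST : S ⊆ T) : SupportedOn C T :=
  fun g hg q hq => hST (h g hg q hq)

theorem SupportedOn.act_apply (h : SupportedOn C S) (x : Q → Bool) {q : Q} (hq : q ∉ S) :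
    act C x q = x q := by
  induction C generalizing x with
  | nil => rfl
  | cons g C ih =>
    rw [supportedOn_cons] at h
    rw [act_cons, ih h.2, g.act_of_notMem_support x (fun hg => hq (h.1 q hg))]

/-- A qubit outside the support may be changed before or after the circuit; this lets an
uncomputation pass the change of the target. -/
theorem SupportedOn.act_update (h : SupportedOn C S) (x : Q → Bool) (v : Bool) {q : Q}
    (hq : q ∉ S) : act C (Function.update x q v) = Function.update (act C x) q v := by
  induction C generalizing x with
  | nil => rfl
  | cons g C ih =>
    rw [supportedOn_cons] at h
    rw [act_cons, g.act_update_of_notMem_support x v (fun hg => hq (h.1 q hg)), ih h.2, act_cons]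

end SupportedOn

/-! ### Time steps, reversal and light cones. -/

/-- The times at which the qubits are released by a circuit when the qubit `q` is available from
time `τ q` on. -/
def release (C : Circuit Q) (τ : Q → ℕ) : Q → ℕ :=
  C.foldl (fun τ g q => if q ∈ g.support then g.support.sup τ + 1 else τ q) τ

@[simp] theorem release_nil (τ : Q → ℕ) : release [] τ = τ := rfl

theorem release_cons (g : Gate Q) (C : Circuit Q) (τ : Q → ℕ) :
    release (g :: C) τ =
      release C (fun q => if q ∈ g.support then g.support.sup τ + 1 else τ q) := rfl

theorem release_append (C D : Circuit Q) (τ : Q → ℕ) :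
    release (C ++ D) τ = release D (release C τ) := List.foldl_append

theorem finishTime_eq_release (C : Circuit Q) : finishTime C = release C fun _ => 0 := rfl

theorem release_mono (C : Circuit Q) {τ σ : Q → ℕ} (h : ∀ q, τ q ≤ σ q) (q : Q) :
    release C τ q ≤ release C σ q := by
  induction C generalizing τ σ with
  | nil => exact h q
  | cons g C ih =>
    refine ih fun p => ?_
    dsimp only
    split_ifs
    · exact Nat.succ_le_succ (Finset.sup_mono_fun fun r _ => h r)
    · exact h p

theorem release_add_le (C : Circuit Q) (τ : Q → ℕ) (c : ℕ) (q : Q) :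
    release C (fun p => τ p + c) q ≤ release C τ q + c := by
  induction C generalizing τ with
  | nil => exact le_rfl
  | cons g C ih =>
    refine le_trans (release_mono C (fun p => ?_) q) (ih _)
    dsimp only
    split_ifs
    · have : g.support.sup (fun p => τ p + c) ≤ g.support.sup τ + c :=
        Finset.sup_le fun r hr => Nat.add_le_add_right (Finset.le_sup (f := τ) hr) c
      omega
    · exact le_rfl

theorem SupportedOn.release_apply {C : Circuit Q} {S : Set Q} (h : SupportedOn C S) (τ : Q → ℕ)
    {q : Q} (hq : q ∉ S) : release C τ q = τ q := by
  induction C generalizing τ with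
  | nil => rfl
  | cons g C ih =>
    rw [supportedOn_cons] at h
    rw [release_cons, ih h.2, if_neg (fun hg => hq (h.1 q hg))]

theorem SupportedOn.release_le {C : Circuit Q} {S : Set Q} (h : SupportedOn C S) {τ : Q → ℕ}
    {t : ℕ} (ht : ∀ q ∈ S, τ q ≤ t) {q : Q} (hq : q ∈ S) : release C τ q ≤ t + C.length := by
  induction C generalizing τ t with
  | nil => exact ht q hq
  | cons g C ih =>
    rw [supportedOn_cons] at h
    rw [release_cons, List.length_cons, ← Nat.add_assoc, Nat.add_right_comm]
    refine ih h.2 fun p hp => ?_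
    split_ifs
    · exact Nat.succ_le_succ (Finset.sup_le fun r hr => ht r (h.1 r hr))
    · exact (ht p hp).trans (Nat.le_succ t)

/-- A schedule of a circuit, read backwards, is a schedule of the reversed circuit. -/
theorem release_reverse_le (C : Circuit Q) (τ : Q → ℕ) (D : ℕ) (hD : ∀ q, release C τ q ≤ D)
    (q : Q) : release C.reverse (fun p => D - release C τ p) q ≤ D - τ q := by
  induction C generalizing τ q with
  | nil => exact le_rfl
  | cons g C ih =>
    rw [release_cons] at hD ⊢
    set σ : Q → ℕ := fun q => if q ∈ g.support then g.support.sup τ + 1 else τ q with hσ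
    -- Release times never decrease along a circuit; hence the truncated subtractions from `D` below
    -- are genuine.
    have hσD : ∀ p, σ p ≤ D := fun p => by
      refine le_trans ?_ (hD p)
      clear hD ih hσ
      clear_value σ
      induction C generalizing σ with
      | nil => exact le_rfl
      | cons g C ih =>
        rw [release_cons]
        refine le_trans ?_ (ih _)
        split_ifs with hp
        · exact (Finset.le_sup (f := σ) hp).trans (Nat.le_succ _)
        · exact le_rfl
    rw [List.reverse_cons, release_append]
    refine (release_mono [g] (fun p => ih σ hD p) q).trans ?_
    rw [release_cons, release_nil]
    split_ifs with hq
    · have hsup : (g.support.sup fun p => D - σ p) ≤ D - (g.support.sup τ + 1) :=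
        Finset.sup_le fun p hp => by simp [hσ, hp]
      have h1 := hσD q
      have h2 : τ q ≤ g.support.sup τ := Finset.le_sup hq
      simp only [hσ, hq, if_true] at h1
      omega
    · simp [hσ, hq]

/-- The circuit `C` takes at most `d` time steps. -/
def DepthLE (C : Circuit Q) (d : ℕ) : Prop := ∀ q, finishTime C q ≤ d

theorem DepthLE.depth_le [Fintype Q] {C : Circuit Q} {d : ℕ} (h : DepthLE C d) : depth C ≤ d :=
  Finset.sup_le fun q _ => h q

theorem DepthLE.release_le {C : Circuit Q} {d : ℕ} (h : DepthLE C d) {τ : Q → ℕ} {t : ℕ}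
    (ht : ∀ q, τ q ≤ t) (q : Q) : release C τ q ≤ t + d := by
  have h1 := release_mono C (σ := fun _ => 0 + t) (fun p => (ht p).trans (by simp)) q
  have h2 := release_add_le C (fun _ => 0) t q
  have h3 := h q
  rw [finishTime_eq_release] at h3
  omega

theorem DepthLE.append {C D : Circuit Q} {c d : ℕ} (hC : DepthLE C c) (hD : DepthLE D d) :
    DepthLE (C ++ D) (c + d) := fun q => by
  rw [finishTime_eq_release, release_append]
  exact hD.release_le hC q

theorem depthLE_length (C : Circuit Q) : DepthLE C C.length := fun q => by
  have h : SupportedOn C Set.univ := fun _ _ _ _ => Set.mem_univ _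
  simpa [finishTime_eq_release] using
    h.release_le (τ := fun _ => 0) (t := 0) (fun _ _ => le_rfl) (Set.mem_univ q)

theorem DepthLE.reverse {C : Circuit Q} {d : ℕ} (h : DepthLE C d) : DepthLE C.reverse d := fun q =>
  (release_mono C.reverse (fun _ => Nat.zero_le _) q).trans
    (release_reverse_le C (fun _ => 0) d h q)

/-- Light cone: after a circuit of gates on at most three qubits, the value of a qubit depends on
at most `3 ^ t` qubits, where `t` is the finishing time of that qubit, and only on qubits touched
by the circuit besides itself. -/
theorem exists_lightCone (C : Circuit Q) (q : Q) :
    ∃ S : Finset Q, S.card ≤ 3 ^ finishTime C q ∧ S.card ≤ 3 * C.length + 1 ∧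
      ∀ x y : Q → Bool, (∀ p ∈ S, x p = y p) → act C x q = act C y q := by
  -- The set `T` of touched qubits is common to all `q`: bounding each cone separately would triple
  -- the bound at every gate, whereas `T` grows by at most three.
  suffices h : ∃ T : Finset Q, T.card ≤ 3 * C.length ∧ ∀ q, ∃ S : Finset Q,
      S.card ≤ 3 ^ finishTime C q ∧ S ⊆ insert q T ∧
      ∀ x y : Q → Bool, (∀ p ∈ S, x p = y p) → act C x q = act C y q by
    obtain ⟨T, hT, h⟩ := h
    obtain ⟨S, h₁, h₂, h₃⟩ := h q
    exact ⟨S, h₁, (Finset.card_le_card h₂).trans ((Finset.card_insert_le _ _).trans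
      (Nat.succ_le_succ hT)), h₃⟩
  induction C using List.reverseRecOn with
  | nil => exact ⟨∅, by simp, fun q => ⟨{q}, by simp [finishTime], by simp, fun x y h => by
      simpa using h⟩⟩
  | append_singleton C g ih =>
    obtain ⟨T, hT, ih⟩ := ih
    choose S h₁ h₂ h₃ using ih
    refine ⟨g.support ∪ T, ?_, fun q => ?_⟩
    · have := Finset.card_union_le g.support T
      have := g.card_support_le
      rw [List.length_append, List.length_singleton]
      omega
    by_cases hq : q ∈ g.support
    · refine ⟨g.support.biUnion S, ?_, ?_, fun x y hxy => ?_⟩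
      · have hf : finishTime (C ++ [g]) q = g.support.sup (finishTime C) + 1 := by
          rw [finishTime_eq_release, release_append, release_cons, release_nil, if_pos hq]
          rfl
        rw [hf, pow_succ, Nat.mul_comm]
        refine (Finset.card_biUnion_le_card_mul _ _ (3 ^ g.support.sup (finishTime C))
          fun p hp => (h₁ p).trans ?_).trans (Nat.mul_le_mul_right _ g.card_support_le)
        exact Nat.pow_le_pow_right (by norm_num) (Finset.le_sup (f := finishTime C) hp)
      · intro p hp
        obtain ⟨r, hr, hpr⟩ := Finset.mem_biUnion.1 hp
        rcases Finset.mem_insert.1 (h₂ r hpr) with rfl | hpT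
        · simp [hr]
        · simp [hpT]
      · simp only [act_append, act_cons, act_nil]
        exact g.act_congr (fun p hp => h₃ p x y fun r hr =>
          hxy r (Finset.mem_biUnion.2 ⟨p, hp, hr⟩)) hq
    · refine ⟨S q, ?_, ?_, fun x y hxy => ?_⟩
      · rw [finishTime_eq_release, release_append, release_cons, release_nil, if_neg hq]
        exact h₁ q
      · exact (h₂ q).trans (Finset.insert_subset_insert _ Finset.subset_union_right)
      · simp only [act_append, act_cons, act_nil]
        rw [g.act_of_notMem_support _ hq, g.act_of_notMem_support _ hq, h₃ q x y hxy]

end Circuit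

/-! ### Digits, and one level of pairwise merges. -/

namespace Circuit

variable {Q : Type*}

/-- The qubits of a list of digits. A digit is a pair of qubits: the first one tells whether the
two compared digits are equal, the second one is the result of the comparison if they are not. -/
def wires : List (Q × Q) → List Q
  | [] => []
  | i :: L => i.1 :: i.2 :: wires L

@[simp] theorem wires_nil : wires ([] : List (Q × Q)) = [] := rfl

@[simp] theorem wires_cons (i : Q × Q) (L : List (Q × Q)) :
    wires (i :: L) = i.1 :: i.2 :: wires L := rfl

@[simp] theorem wires_append (L M : List (Q × Q)) : wires (L ++ M) = wires L ++ wires M := by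
  induction L <;> simp [*]

/-- The result of the comparison encoded in a list of digits, the most significant one first;
`none` if all the digits are equal. -/
def outcome : List (Q × Q) → (Q → Bool) → Option Bool
  | [], _ => none
  | i :: L, x => if x i.1 then outcome L x else some (x i.2)

@[simp] theorem outcome_nil (x : Q → Bool) : outcome [] x = none := rfl

@[simp] theorem outcome_cons (i : Q × Q) (L : List (Q × Q)) (x : Q → Bool) :
    outcome (i :: L) x = if x i.1 then outcome L x else some (x i.2) := rfl

theorem outcome_append (L M : List (Q × Q)) (x : Q → Bool) :
    outcome (L ++ M) x = (outcome L x).or (outcome M x) := by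
  induction L with
  | nil => simp
  | cons i L ih => by_cases h : x i.1 <;> simp [h, ih]

theorem outcome_congr {L : List (Q × Q)} {x y : Q → Bool} (h : ∀ q ∈ wires L, x q = y q) :
    outcome L x = outcome L y := by
  induction L with
  | nil => rfl
  | cons i L ih =>
    simp only [wires_cons, List.mem_cons, forall_eq_or_imp] at h
    simp [h.1, h.2.1, ih h.2.2]

variable [DecidableEq Q]

/-- The circuit consisting of one `CX` gate (empty when the qubits are not distinct). -/
def cx (c t : Q) : Circuit Q := if h : c ≠ t then [Gate.CX c t h] else []

/-- The circuit consisting of one `CCX` gate (empty when the qubits are not distinct). -/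
def ccx (c₁ c₂ t : Q) : Circuit Q :=
  if h : c₁ ≠ c₂ ∧ c₁ ≠ t ∧ c₂ ≠ t then [Gate.CCX c₁ c₂ t h.1 h.2.1 h.2.2] else []

theorem act_cx {c t : Q} (h : c ≠ t) (x : Q → Bool) :
    act (cx c t) x = Function.update x t (xor (x t) (x c)) := by
  simp [cx, h, Gate.act]

theorem act_ccx {c₁ c₂ t : Q} (h₁₂ : c₁ ≠ c₂) (h₁ : c₁ ≠ t) (h₂ : c₂ ≠ t) (x : Q → Bool) :
    act (ccx c₁ c₂ t) x = Function.update x t (xor (x t) (x c₁ && x c₂)) := by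
  simp [ccx, h₁₂, h₁, h₂, Gate.act]

theorem length_cx_le (c t : Q) : (cx c t).length ≤ 1 := by
  unfold cx; split_ifs <;> simp

theorem length_ccx_le (c₁ c₂ t : Q) : (ccx c₁ c₂ t).length ≤ 1 := by
  unfold ccx; split_ifs <;> simp

theorem supportedOn_cx {c t : Q} {S : Set Q} (hc : c ∈ S) (ht : t ∈ S) :
    SupportedOn (cx c t) S := by
  unfold cx; split_ifs <;> simp [Gate.support, hc, ht]

theorem supportedOn_ccx {c₁ c₂ t : Q} {S : Set Q} (h₁ : c₁ ∈ S) (h₂ : c₂ ∈ S) (ht : t ∈ S) :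
    SupportedOn (ccx c₁ c₂ t) S := by
  unfold ccx; split_ifs <;> simp [Gate.support, h₁, h₂, ht]

/-- Merges two consecutive digits `i` and `j` into one digit `(q, i.2)`, where `q` is in state `0`.
If the merged digit is that of equal digits, this leaves `i.1` and `j.1` in state `0`. -/
def merge (q : Q) (i j : Q × Q) : Circuit Q :=
  cx i.2 j.2 ++ ccx i.1 j.2 i.2 ++ ccx i.1 j.1 q ++ [Gate.X i.1, Gate.X j.1]

theorem length_merge_le (q : Q) (i j : Q × Q) : (merge q i j).length ≤ 5 := by
  have h₁ := length_cx_le i.2 j.2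
  have h₂ := length_ccx_le i.1 j.2 i.2
  have h₃ := length_ccx_le i.1 j.1 q
  simp only [merge, List.length_append, List.length_cons, List.length_nil]
  omega

theorem supportedOn_merge {q : Q} {i j : Q × Q} {S : Set Q} (hq : q ∈ S) (hi₁ : i.1 ∈ S)
    (hi₂ : i.2 ∈ S) (hj₁ : j.1 ∈ S) (hj₂ : j.2 ∈ S) : SupportedOn (merge q i j) S := by
  simp [merge, supportedOn_cx, supportedOn_ccx, Gate.support, *]

/-- After `cx i.2 j.2` the qubit `j.2` holds the sum of both values, so adding it to `i.2` under the
control `i.1` is a conditional copy. The final flips make both flags `0` when both were `1`. -/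
theorem act_merge {q : Q} {i j : Q × Q} (hn : (q :: wires [i, j]).Nodup) {x : Q → Bool}
    (hx : x q = false) :
    act (merge q i j) x q = (x i.1 && x j.1) ∧
    act (merge q i j) x i.2 = (if x i.1 then x j.2 else x i.2) ∧
    act (merge q i j) x i.1 = !(x i.1) ∧ act (merge q i j) x j.1 = !(x j.1) := by
  simp only [wires_cons, wires_nil, List.nodup_cons, List.mem_cons, List.not_mem_nil, or_false,
    not_or, List.nodup_nil, not_false_eq_true, and_true] at hn
  obtain ⟨⟨h1, h2, h3, h4⟩, ⟨h5, h6, h7⟩, ⟨h8, h9⟩, h10⟩ := hn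
  have h1' := Ne.symm h1
  have h2' := Ne.symm h2
  have h3' := Ne.symm h3
  have h4' := Ne.symm h4
  have h5' := Ne.symm h5
  have h6' := Ne.symm h6
  have h7' := Ne.symm h7
  have h8' := Ne.symm h8
  have h9' := Ne.symm h9
  have h10' := Ne.symm h10
  simp only [merge, act_append, act_cx h9, act_ccx h7 h5 h9', act_ccx h6 h1' h3', act_cons,
    act_nil, Gate.act]
  refine ⟨?_, ?_, ?_, ?_⟩ <;> simp [*]
  cases x i.1 <;> cases x i.2 <;> cases x j.2 <;> rfl

/-- Merges the digits of a list two by two, as long as there are qubits `qs` available in state `0`.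
Returns the circuit, the list of the new digits, and the list of the released qubits. -/
def foldLevel : List Q → List (Q × Q) → Circuit Q × List (Q × Q) × List Q
  | q :: qs, i :: j :: L =>
    (merge q i j ++ (foldLevel qs L).1, (q, i.2) :: (foldLevel qs L).2.1,
      i.1 :: j.1 :: (foldLevel qs L).2.2)
  | _, L => ([], L, [])

theorem perm_merge (q : Q) (i j : Q × Q) (l : List Q) (L : List (Q × Q)) :
    ((q :: l) ++ wires (i :: j :: L)).Perm ((q :: wires [i, j]) ++ (l ++ wires L)) := by
  rw [List.perm_iff_count]
  intro a
  simp only [wires_cons, wires_nil, List.count_append, List.count_cons, List.count_nil]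
  ring

theorem nodup_merge {q : Q} {i j : Q × Q} {l : List Q} {L : List (Q × Q)}
    (h : ((q :: l) ++ wires (i :: j :: L)).Nodup) :
    (q :: wires [i, j]).Nodup ∧ (l ++ wires L).Nodup ∧
      ∀ a ∈ q :: wires [i, j], a ∉ l ++ wires L := by
  rw [(perm_merge q i j l L).nodup_iff, List.nodup_append] at h
  exact ⟨h.1, h.2.1, fun a ha hb => h.2.2 a ha a hb rfl⟩

/-- Inclusion of multisets gives both the distinctness and the origin of the output qubits. It may
be strict, since `j.2` is discarded by a merge. -/
theorem count_foldLevel_le (qs : List Q) (L : List (Q × Q)) (a : Q) :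
    ((foldLevel qs L).2.2 ++ wires (foldLevel qs L).2.1).count a ≤ (qs ++ wires L).count a := by
  induction qs, L using foldLevel.induct with
  | case1 q qs i j L ih =>
    simp only [foldLevel, wires_cons, List.count_append, List.count_cons] at ih ⊢
    omega
  | case2 qs L h =>
    rw [foldLevel]
    · simp
    · exact h

theorem supportedOn_foldLevel (qs : List Q) (L : List (Q × Q)) :
    SupportedOn (foldLevel qs L).1 {a | a ∈ qs ++ wires L} := by
  induction qs, L using foldLevel.induct with
  | case1 q qs i j L ih =>
    rw [foldLevel, supportedOn_append]
    refine ⟨supportedOn_merge ?_ ?_ ?_ ?_ ?_, ih.mono fun a ha => ?_⟩ <;> simp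
    simp only [Set.mem_ofPred_eq, List.mem_append] at ha
    tauto
  | case2 qs L h =>
    rw [foldLevel]
    · simp
    · exact h

/-- A merge costs at most five gates and removes one digit, so gates plus five times the digits is a
potential that never grows. The same potential bounds blocks and rounds. -/
theorem length_foldLevel (qs : List Q) (L : List (Q × Q)) :
    (foldLevel qs L).1.length + 5 * (foldLevel qs L).2.1.length ≤ 5 * L.length := by
  induction qs, L using foldLevel.induct with
  | case1 q qs i j L ih =>
    have := length_merge_le q i j
    simp only [foldLevel, List.length_append, List.length_cons]
    omega
  | case2 qs L h =>
    rw [foldLevel]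
    · simp
    · exact h

theorem foldLevel_card (qs : List Q) (L : List (Q × Q)) {m : ℕ} (hm : m ≤ qs.length)
    (hL : L.length ≤ 2 * m) :
    (foldLevel qs L).2.1.length ≤ m ∧
      (L.length = 2 * m →
        (foldLevel qs L).2.1.length = m ∧ (foldLevel qs L).2.2.length = 2 * m) := by
  induction qs, L using foldLevel.induct generalizing m with
  | case1 q qs i j L ih =>
    simp only [foldLevel, List.length_cons] at hm hL ⊢
    obtain ⟨h₁, h₂⟩ := ih (m := m - 1) (by omega) (by omega)
    exact ⟨by omega, fun h => ⟨by have := h₂ (by omega); omega, by have := h₂ (by omega); omega⟩⟩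
  | case2 qs L h =>
    rw [foldLevel]
    · match qs, L, h with
      | _, [], _ => simp at hL ⊢; omega
      | _, [i], _ => simp at hL ⊢; omega
      | [], i :: j :: L, _ => simp at hm hL; omega
      | q :: qs, i :: j :: L, h => exact absurd rfl (h q qs i j L rfl)
    · exact h

theorem outcome_foldLevel (qs : List Q) (L : List (Q × Q)) (hn : (qs ++ wires L).Nodup)
    (x : Q → Bool) (hx : ∀ q ∈ qs, x q = false) :
    outcome (foldLevel qs L).2.1 (act (foldLevel qs L).1 x) = outcome L x ∧
      (outcome L x = none → ∀ q ∈ (foldLevel qs L).2.2, act (foldLevel qs L).1 x q = false) := by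
  induction qs, L using foldLevel.induct generalizing x with
  | case1 q qs i j L ih =>
    obtain ⟨h₁, h₂, h₃⟩ := nodup_merge hn
    simp only [List.mem_cons, forall_eq_or_imp] at hx
    obtain ⟨hy₁, hy₂, hy₃, hy₄⟩ := act_merge h₁ hx.1
    have hkeep : ∀ a ∈ qs ++ wires L, act (merge q i j) x a = x a := fun a ha =>
      (supportedOn_merge (S := {a | a ∈ q :: wires [i, j]}) (by simp) (by simp) (by simp)
        (by simp) (by simp)).act_apply x fun h => h₃ a h ha
    have hkeep' : ∀ a ∈ q :: wires [i, j], ∀ y, act (foldLevel qs L).1 y a = y a :=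
      fun a ha y => (supportedOn_foldLevel qs L).act_apply y (h₃ a ha)
    have hout : outcome L (act (merge q i j) x) = outcome L x :=
      outcome_congr fun a ha => hkeep a (List.mem_append_right _ ha)
    obtain ⟨ih₁, ih₂⟩ := ih h₂ (act (merge q i j) x) fun a ha => by
      rw [hkeep a (List.mem_append_left _ ha), hx.2 a ha]
    simp only [wires_cons, wires_nil, List.mem_cons, List.not_mem_nil, or_false,
      forall_eq_or_imp, forall_eq] at hkeep'
    obtain ⟨hk₁, hk₂, hk₃, hk₄, -⟩ := hkeep'
    simp only [foldLevel, act_append, outcome_cons, List.mem_cons, forall_eq_or_imp, hk₁, hk₂, hk₃,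
      hk₄, hy₁, hy₂, hy₃, hy₄, ih₁]
    rw [hout] at ih₂ ⊢
    cases hi : x i.1 <;> cases hj : x j.1 <;> simp
    exact ih₂
  | case2 qs L h =>
    rw [foldLevel]
    · simp
    · exact h

/-- The merges of a level act on disjoint sets of qubits, hence run in parallel, in the five steps
of a single one. -/
theorem release_foldLevel (qs : List Q) (L : List (Q × Q)) (hn : (qs ++ wires L).Nodup)
    (τ : Q → ℕ) (t : ℕ) (hτ : ∀ a ∈ qs ++ wires L, τ a ≤ t) :
    ∀ a ∈ qs ++ wires L, release (foldLevel qs L).1 τ a ≤ t + 5 := by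
  induction qs, L using foldLevel.induct generalizing τ with
  | case1 q qs i j L ih =>
    obtain ⟨h₁, h₂, h₃⟩ := nodup_merge hn
    have hs : SupportedOn (merge q i j) {a | a ∈ q :: wires [i, j]} :=
      supportedOn_merge (by simp) (by simp) (by simp) (by simp) (by simp)
    have hmem : ∀ a, a ∈ (q :: qs) ++ wires (i :: j :: L) ↔
        a ∈ q :: wires [i, j] ∨ a ∈ qs ++ wires L := fun a => by
      rw [(perm_merge q i j qs L).mem_iff, List.mem_append]
    intro a ha
    rw [foldLevel, release_append]
    rcases (hmem a).1 ha with h | h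
    · rw [(supportedOn_foldLevel qs L).release_apply _ (h₃ a h)]
      exact (hs.release_le (fun p hp => hτ p ((hmem p).2 (Or.inl hp))) h).trans
        (Nat.add_le_add_left (length_merge_le q i j) t)
    · refine ih h₂ _ (fun p hp => ?_) a h
      rw [hs.release_apply _ fun h => h₃ p h hp]
      exact hτ p ((hmem p).2 (Or.inr hp))
  | case2 qs L h =>
    intro a ha
    rw [foldLevel]
    · exact (hτ a ha).trans (Nat.le_add_right t 5)
    · exact h

end Circuit

/-! ### Blocks: trees of merges and the qubits they release. -/

namespace Circuit

variable {Q : Type*}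

/-- The qubits of the successive lists are available from the times `t`, `t + 5`, … on. -/
def Ready (τ : Q → ℕ) : ℕ → List (List Q) → Prop
  | _, [] => True
  | t, A :: As => (∀ a ∈ A, τ a ≤ t) ∧ Ready τ (t + 5) As

theorem Ready.congr {τ σ : Q → ℕ} {t : ℕ} {As : List (List Q)} (h : Ready τ t As)
    (hσ : ∀ a ∈ As.flatten, σ a = τ a) : Ready σ t As := by
  induction As generalizing t with
  | nil => trivial
  | cons A As ih =>
    simp only [List.flatten_cons, List.mem_append, or_imp, forall_and] at hσ
    exact ⟨fun a ha => (hσ.1 a ha).trans_le (h.1 a ha), ih h.2 hσ.2⟩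

theorem Ready.le {τ : Q → ℕ} {t : ℕ} {As : List (List Q)} (h : Ready τ t As) {a : Q}
    (ha : a ∈ As.flatten) : τ a ≤ t + 5 * As.length := by
  induction As generalizing t with
  | nil => simp at ha
  | cons A As ih =>
    rw [List.length_cons]
    rcases List.mem_append.1 (List.flatten_cons ▸ ha) with ha | ha
    · exact (h.1 a ha).trans (by omega)
    · exact (ih h.2 ha).trans (by omega)

theorem Ready.append_singleton {τ : Q → ℕ} {t : ℕ} {As : List (List Q)} (h : Ready τ t As) {s : Q}
    (hs : τ s ≤ t) : Ready τ t (As ++ [[s]]) := by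
  induction As generalizing t with
  | nil => simpa [Ready] using hs
  | cons A As ih => exact ⟨h.1, ih h.2 (by omega)⟩

variable [DecidableEq Q]

theorem nodup_of_count_le {l m : List Q} (h : ∀ a, l.count a ≤ m.count a) (hm : m.Nodup) :
    l.Nodup :=
  List.nodup_iff_count_le_one.2 fun a => (h a).trans (List.nodup_iff_count_le_one.1 hm a)

theorem mem_of_count_le {l m : List Q} (h : ∀ a, l.count a ≤ m.count a) {a : Q} (ha : a ∈ l) :
    a ∈ m :=
  List.count_pos_iff.1 ((List.count_pos_iff.2 ha).trans_le (h a))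

/-- Merges a block of digits two by two repeatedly. The qubits of `As`, in state `0`, are
used up level by level. Returns the circuit, the list of the remaining digits, and the lists of the
qubits released by the levels. -/
def foldBlock : List (List Q) → List (Q × Q) → Circuit Q × List (Q × Q) × List (List Q)
  | [], L => ([], L, [])
  | A :: As, L =>
    ((foldLevel A L).1 ++ (foldBlock As (foldLevel A L).2.1).1,
      (foldBlock As (foldLevel A L).2.1).2.1,
      (foldLevel A L).2.2 :: (foldBlock As (foldLevel A L).2.1).2.2)

theorem count_foldBlock_le (As : List (List Q)) (L : List (Q × Q)) (a : Q) :
    ((foldBlock As L).2.2.flatten ++ wires (foldBlock As L).2.1).count a ≤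
      (As.flatten ++ wires L).count a := by
  induction As generalizing L with
  | nil => simp [foldBlock]
  | cons A As ih =>
    have h₁ := count_foldLevel_le A L a
    have h₂ := ih (foldLevel A L).2.1
    simp only [foldBlock, List.flatten_cons, List.count_append] at h₁ h₂ ⊢
    omega

theorem count_foldLevel_append_le (A B : List Q) (L : List (Q × Q)) (a : Q) :
    ((foldLevel A L).2.2 ++ (B ++ wires (foldLevel A L).2.1)).count a ≤
      ((A ++ B) ++ wires L).count a := by
  have h₁ := count_foldLevel_le A L a
  simp only [List.count_append] at h₁ ⊢
  omega

theorem supportedOn_foldBlock (As : List (List Q)) (L : List (Q × Q)) :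
    SupportedOn (foldBlock As L).1 {a | a ∈ As.flatten ++ wires L} := by
  induction As generalizing L with
  | nil => simp [foldBlock]
  | cons A As ih =>
    rw [foldBlock, supportedOn_append]
    refine ⟨(supportedOn_foldLevel A L).mono fun a ha => ?_, (ih _).mono fun a ha => ?_⟩
    · simp only [Set.mem_ofPred_eq, List.flatten_cons, List.mem_append] at ha ⊢
      tauto
    · exact mem_of_count_le (count_foldLevel_append_le A As.flatten L)
        (List.mem_append_right _ ha)

theorem length_foldBlock (As : List (List Q)) (L : List (Q × Q)) :
    (foldBlock As L).1.length + 5 * (foldBlock As L).2.1.length ≤ 5 * L.length := by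
  induction As generalizing L with
  | nil => simp [foldBlock]
  | cons A As ih =>
    have h₁ := length_foldLevel A L
    have h₂ := ih (foldLevel A L).2.1
    simp only [foldBlock, List.length_append]
    omega

theorem length_foldBlock_released (As : List (List Q)) (L : List (Q × Q)) :
    (foldBlock As L).2.2.length = As.length := by
  induction As generalizing L with
  | nil => rfl
  | cons A As ih => simp [foldBlock, ih]

/-- The `k` lists have at least `2 ^ (k - 1)`, …, `2`, `1` elements. -/
def Full : List (List Q) → Prop
  | [] => True
  | A :: As => 2 ^ As.length ≤ A.length ∧ Full As

/-- A level that merges `2 * m` digits uses `m` clean qubits and releases `2 * m`. Every pool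
therefore doubles, and one extra qubit `s` completes the pools for a block twice as long. -/
theorem foldBlock_card (As : List (List Q)) (L : List (Q × Q)) (hA : Full As)
    (hL : L.length ≤ 2 ^ As.length) :
    (foldBlock As L).2.1.length ≤ 1 ∧
      (L.length = 2 ^ As.length → ∀ s, Full ((foldBlock As L).2.2 ++ [[s]])) := by
  induction As generalizing L with
  | nil => exact ⟨by simpa [foldBlock] using hL, fun _ s => by simp [foldBlock, Full]⟩
  | cons A As ih =>
    rw [List.length_cons, pow_succ, Nat.mul_comm] at hL ⊢
    obtain ⟨h₁, h₂⟩ := foldLevel_card A L hA.1 hL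
    obtain ⟨h₃, h₄⟩ := ih (foldLevel A L).2.1 hA.2 h₁
    refine ⟨h₃, fun h s => ⟨?_, h₄ (h₂ h).1 s⟩⟩
    rw [(h₂ h).2, List.append_eq, List.length_append, length_foldBlock_released, List.length_singleton, pow_succ,
      Nat.mul_comm]

theorem outcome_foldBlock (As : List (List Q)) (L : List (Q × Q))
    (hn : (As.flatten ++ wires L).Nodup) (x : Q → Bool) (hx : ∀ q ∈ As.flatten, x q = false) :
    outcome (foldBlock As L).2.1 (act (foldBlock As L).1 x) = outcome L x ∧
      (outcome L x = none →
        ∀ q ∈ (foldBlock As L).2.2.flatten, act (foldBlock As L).1 x q = false) := by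
  induction As generalizing L x with
  | nil => simp [foldBlock]
  | cons A As ih =>
    have hn' := nodup_of_count_le (count_foldLevel_append_le A As.flatten L) hn
    rw [List.nodup_append] at hn'
    obtain ⟨-, hn₁, hn₂⟩ := hn'
    rw [List.flatten_cons, List.append_assoc, List.nodup_append] at hn
    obtain ⟨hn₃, hn₄, hn₅⟩ := hn
    rw [List.nodup_append] at hn₄
    simp only [List.flatten_cons, List.mem_append, or_imp, forall_and] at hx
    obtain ⟨h₁, h₂⟩ := outcome_foldLevel A L (List.nodup_append.2 ⟨hn₃, hn₄.2.1, fun a ha b hb =>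
      hn₅ a ha b (List.mem_append_right _ hb)⟩) x hx.1
    obtain ⟨h₃, h₄⟩ := ih (foldLevel A L).2.1 hn₁ (act (foldLevel A L).1 x) fun a ha => by
      rw [(supportedOn_foldLevel A L).act_apply x, hx.2 a ha]
      rw [Set.mem_ofPred_eq, List.mem_append]
      rintro (h | h)
      · exact hn₅ a h a (List.mem_append_left _ ha) rfl
      · exact hn₄.2.2 a ha a h rfl
    simp only [foldBlock, act_append, List.flatten_cons, List.mem_append]
    rw [h₁] at h₃ h₄
    refine ⟨h₃, fun h a ha => ?_⟩
    rcases ha with ha | ha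
    · rw [(supportedOn_foldBlock As _).act_apply _ fun hb => hn₂ a ha a hb rfl]
      exact h₂ h a ha
    · exact h₄ h a ha

/-- Each level frees its pool as soon as it is done, so the next block, started five steps later,
finds each pool ready when its own corresponding level begins. -/
theorem release_foldBlock (As : List (List Q)) (L : List (Q × Q))
    (hn : (As.flatten ++ wires L).Nodup) (τ : Q → ℕ) (t : ℕ) (hA : Ready τ t As)
    (hL : ∀ a ∈ wires L, τ a ≤ t) :
    Ready (release (foldBlock As L).1 τ) (t + 5) (foldBlock As L).2.2 ∧
      ∀ a ∈ As.flatten ++ wires L, release (foldBlock As L).1 τ a ≤ t + 5 * As.length := by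
  induction As generalizing L τ t with
  | nil => exact ⟨trivial, fun a ha => hL a (by simpa using ha)⟩
  | cons A As ih =>
    have hn' := nodup_of_count_le (count_foldLevel_append_le A As.flatten L) hn
    rw [List.nodup_append] at hn'
    obtain ⟨-, hn₁, hn₂⟩ := hn'
    rw [List.flatten_cons, List.append_assoc, List.nodup_append] at hn
    obtain ⟨hn₃, hn₄, hn₅⟩ := hn
    rw [List.nodup_append] at hn₄
    have hlev := release_foldLevel A L (List.nodup_append.2 ⟨hn₃, hn₄.2.1, fun a ha b hb =>
      hn₅ a ha b (List.mem_append_right _ hb)⟩) τ t fun a ha => (List.mem_append.1 ha).elim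
        (hA.1 a) (hL a)
    have hAs : Ready (release (foldLevel A L).1 τ) (t + 5) As := hA.2.congr fun a ha => by
      rw [(supportedOn_foldLevel A L).release_apply]
      rw [Set.mem_ofPred_eq, List.mem_append]
      rintro (h | h)
      · exact hn₅ a h a (List.mem_append_left _ ha) rfl
      · exact hn₄.2.2 a ha a h rfl
    obtain ⟨h₁, h₂⟩ := ih (foldLevel A L).2.1 hn₁ _ (t + 5) hAs fun a ha =>
      hlev a (mem_of_count_le (count_foldLevel_le A L) (List.mem_append_right _ ha))
    rw [foldBlock, release_append]
    refine ⟨⟨fun a ha => ?_, h₁⟩, fun a ha => ?_⟩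
    · rw [(supportedOn_foldBlock As _).release_apply _ fun hb => hn₂ a ha a hb rfl]
      exact hlev a (mem_of_count_le (count_foldLevel_le A L) (List.mem_append_left _ ha))
    · by_cases hb : a ∈ As.flatten ++ wires (foldLevel A L).2.1
      · exact (h₂ a hb).trans (by rw [List.length_cons]; omega)
      · rw [(supportedOn_foldBlock As _).release_apply _ hb]
        refine (hlev a ?_).trans (by rw [List.length_cons]; omega)
        simp only [List.flatten_cons, List.mem_append] at ha hb ⊢
        tauto

end Circuit

/-! ### Pipelined rounds on blocks of doubling length, and the final ladder. -/

namespace Circuit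

variable {Q : Type*} [DecidableEq Q]

/-- Merges a list of digits, the most significant one first, in `m` rounds, given lists of qubits
`As` and a qubit `s` in state `0`. A round merges the first two digits, which releases a new qubit
for the next round, and a block of digits that is twice as long as that of the previous round.
The qubits that a round uses are only required to be in state `0` if all the digits merged in the
previous rounds are those of equal digits, and so they can be the qubits released by these rounds.
Returns the circuit, the list of the remaining digits, and the last released qubit. -/
def foldBlocks : ℕ → List (List Q) → Q → List (Q × Q) → Circuit Q × List (Q × Q) × Q
  | m + 1, As, s, i :: j :: L =>
    let B := foldBlock As (L.take (2 ^ As.length))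
    let R := foldBlocks m (B.2.2 ++ [[i.1]]) j.1 (L.drop (2 ^ As.length))
    (merge s i j ++ (B.1 ++ R.1), (s, i.2) :: (B.2.1 ++ R.2.1), R.2.2)
  | _, _, s, L => ([], L, s)

theorem count_wires_take_drop (n : ℕ) (L : List (Q × Q)) (a : Q) :
    (wires (L.take n)).count a + (wires (L.drop n)).count a = (wires L).count a := by
  rw [← List.count_append, ← wires_append, List.take_append_drop]

/-- After one round the qubits split into the seed digit, the remaining block digits, and the seed,
pools and digits of the later rounds; this disjointness drives the inductions on the rounds. -/
theorem count_foldBlock_append_le (As : List (List Q)) (s : Q) (i j : Q × Q) (L : List (Q × Q))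
    (n : ℕ) (a : Q) :
    ([s, i.2] ++ (wires (foldBlock As (L.take n)).2.1 ++
      (j.1 :: (((foldBlock As (L.take n)).2.2 ++ [[i.1]]).flatten ++ wires (L.drop n))))).count a ≤
    (s :: (As.flatten ++ wires (i :: j :: L))).count a := by
  have h₁ := count_foldBlock_le As (L.take n) a
  have h₂ := count_wires_take_drop n L a
  simp only [wires_cons, List.count_append, List.count_cons, List.count_nil, List.flatten_append,
    List.flatten_cons, List.flatten_nil] at h₁ ⊢
  omega

theorem count_foldBlocks_le (m : ℕ) (As : List (List Q)) (s : Q) (L : List (Q × Q)) (a : Q) :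
    ((foldBlocks m As s L).2.2 :: wires (foldBlocks m As s L).2.1).count a ≤
      (s :: (As.flatten ++ wires L)).count a := by
  induction m, As, s, L using foldBlocks.induct with
  | case1 m As s i j L B ih =>
    have h := count_foldBlock_append_le As s i j L (2 ^ As.length) a
    simp only [foldBlocks, wires_cons, wires_append, List.count_append, List.count_cons,
      List.count_nil, B] at h ih ⊢
    omega
  | case2 m As s L h =>
    rw [foldBlocks]
    · simp [List.count_cons]
    · exact h

theorem supportedOn_foldBlocks (m : ℕ) (As : List (List Q)) (s : Q) (L : List (Q × Q)) :
    SupportedOn (foldBlocks m As s L).1 {a | a ∈ s :: (As.flatten ++ wires L)} := by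
  induction m, As, s, L using foldBlocks.induct with
  | case1 m As s i j L B ih =>
    simp only [foldBlocks, supportedOn_append]
    refine ⟨supportedOn_merge (by simp) (by simp) (by simp) (by simp) (by simp),
      (supportedOn_foldBlock _ _).mono fun a ha => ?_,
      ih.mono fun a ha => mem_of_count_le (count_foldBlock_append_le As s i j L (2 ^ As.length))
        (List.mem_append_right _ (List.mem_append_right _ ha))⟩
    have h := count_wires_take_drop (2 ^ As.length) L
    refine mem_of_count_le (fun a => ?_) ha
    simp only [wires_cons, List.count_append, List.count_cons]
    have := h a
    omega
  | case2 m As s L h =>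
    rw [foldBlocks]
    · simp
    · exact h

theorem length_foldBlocks (m : ℕ) (As : List (List Q)) (s : Q) (L : List (Q × Q)) :
    (foldBlocks m As s L).1.length + 5 * (foldBlocks m As s L).2.1.length ≤ 5 * L.length := by
  induction m, As, s, L using foldBlocks.induct with
  | case1 m As s i j L B ih =>
    have h₁ := length_merge_le s i j
    have h₂ := length_foldBlock As (L.take (2 ^ As.length))
    have h₃ := congrArg List.length (List.take_append_drop (2 ^ As.length) L)
    rw [List.length_append] at h₃
    simp only [foldBlocks, List.length_append, List.length_cons, B] at ih ⊢
    omega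
  | case2 m As s L h =>
    rw [foldBlocks]
    · simp
    · exact h

/-- The blocks of `m` rounds have `2 ^ k + … + 2 ^ (k + m - 1) = 2 ^ (k + m) - 2 ^ k` digits, where
`k = As.length`; each round leaves its seed digit and at most one block digit. -/
theorem foldBlocks_card (m : ℕ) (As : List (List Q)) (s : Q) (L : List (Q × Q))
    (hA : 2 ≤ L.length → Full As) (hL : L.length + 2 ^ As.length ≤ 2 ^ (As.length + m)) :
    (foldBlocks m As s L).2.1.length ≤ 2 * m := by
  induction m, As, s, L using foldBlocks.induct with
  | case1 m As s i j L B ih =>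
    have hF := hA (by simp)
    obtain ⟨h₁, h₂⟩ := foldBlock_card As (L.take (2 ^ As.length)) hF (by simp)
    have hlen : (B.2.2 ++ [[i.1]]).length = As.length + 1 := by
      rw [List.length_append, length_foldBlock_released, List.length_singleton]
    -- If the block is cut short, no digit is left for later rounds, so their pools need to be full
    -- only when the block was complete.
    have h₃ := ih (fun h => h₂ (by rw [List.length_drop] at h; rw [List.length_take]; omega) i.1)
      (by
        rw [hlen, List.length_drop, Nat.add_right_comm, Nat.add_assoc, pow_succ]
        simp only [List.length_cons, Nat.succ_eq_add_one] at hL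
        have : 2 ^ As.length * 2 ≤ 2 ^ (As.length + (m + 1)) := by
          rw [← pow_succ]
          exact Nat.pow_le_pow_right (by norm_num) (by omega)
        omega)
    simp only [foldBlocks, List.length_append, List.length_cons, B] at h₃ ⊢
    omega
  | case2 m As s L h =>
    rw [foldBlocks]
    · match m, L, h with
      | 0, L, _ => exact (by simpa using hL : L.length = 0).le
      | m + 1, [], _ => simp
      | m + 1, [i], _ => simp; omega
      | m + 1, i :: j :: L, h => exact absurd rfl (h m i j L rfl)
    · exact h

/-- The later rounds are correct only on clean qubits, which they get exactly when the earlier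
digits are all equal. Otherwise the earlier digits already decide the outcome. -/
theorem outcome_foldBlocks (m : ℕ) (As : List (List Q)) (s : Q) (L : List (Q × Q))
    (hn : (s :: (As.flatten ++ wires L)).Nodup) (x : Q → Bool)
    (hx : ∀ q ∈ s :: As.flatten, x q = false) :
    outcome (foldBlocks m As s L).2.1 (act (foldBlocks m As s L).1 x) = outcome L x ∧
      (outcome L x = none →
        act (foldBlocks m As s L).1 x (foldBlocks m As s L).2.2 = false) := by
  induction m, As, s, L using foldBlocks.induct generalizing x with
  | case1 m As s i j L B ih =>
    set n := 2 ^ As.length with hn_def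
    have hn' := nodup_of_count_le (count_foldBlock_append_le As s i j L n) hn
    rw [List.nodup_append, List.nodup_append] at hn'
    obtain ⟨-, ⟨-, hnR, hBR⟩, hsR⟩ := hn'
    rw [← List.cons_append] at hn
    obtain ⟨h₁, h₂, h₃⟩ := nodup_merge hn
    have h₄ : ((As.flatten ++ wires (L.take n)) ++ wires (L.drop n)).Nodup := by
      rwa [List.append_assoc, ← wires_append, List.take_append_drop]
    rw [List.nodup_append] at h₄
    obtain ⟨hnB, -, hBdrop⟩ := h₄
    have hmemB : ∀ a, a ∈ As.flatten ++ wires (L.take n) → a ∈ As.flatten ++ wires L :=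
      fun a ha => by
        rw [← List.take_append_drop n L, wires_append, ← List.append_assoc]
        exact List.mem_append_left _ ha
    have hwL : wires L = wires (L.take n) ++ wires (L.drop n) := by
      rw [← wires_append, List.take_append_drop]
    rw [List.forall_mem_cons] at hx
    obtain ⟨hy₁, hy₂, hy₃, hy₄⟩ := act_merge h₁ hx.1
    set y := act (merge s i j) x with hy
    have hyx : ∀ a ∈ As.flatten ++ wires L, y a = x a := fun a ha =>
      (supportedOn_merge (S := {a | a ∈ s :: wires [i, j]}) (by simp) (by simp) (by simp)
        (by simp) (by simp)).act_apply x fun h => h₃ a h ha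
    obtain ⟨hB₁, hB₂⟩ := outcome_foldBlock As (L.take n) hnB y fun a ha => by
      rw [hyx a (List.mem_append_left _ ha), hx.2 a ha]
    rw [outcome_congr (y := x) fun a ha => hyx a (hmemB a (List.mem_append_right _ ha))] at hB₁ hB₂
    set z := act (foldBlock As (L.take n)).1 y with hz
    have hzy : ∀ a ∈ s :: wires [i, j], z a = y a := fun a ha =>
      (supportedOn_foldBlock As (L.take n)).act_apply y fun h => h₃ a ha (hmemB a h)
    have hzR : outcome (L.drop n) z = outcome (L.drop n) x := outcome_congr fun a ha => by
      rw [hz, (supportedOn_foldBlock As (L.take n)).act_apply y fun h => hBdrop a h a ha rfl]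
      exact hyx a (List.mem_append_right _ (hwL ▸ List.mem_append_right _ ha))
    have hkeep := supportedOn_foldBlocks m (B.2.2 ++ [[i.1]]) j.1 (L.drop n)
    have hBw : outcome B.2.1 (act (foldBlocks m (B.2.2 ++ [[i.1]]) j.1 (L.drop n)).1 z) =
        outcome B.2.1 z := outcome_congr fun a ha => hkeep.act_apply z fun h => hBR a ha a h rfl
    have hsw : ∀ a ∈ [s, i.2], act (foldBlocks m (B.2.2 ++ [[i.1]]) j.1 (L.drop n)).1 z a = z a :=
      fun a ha => hkeep.act_apply z fun h => hsR a ha a (List.mem_append_right _ h) rfl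
    have hL : outcome L x = (outcome (L.take n) x).or (outcome (L.drop n) x) := by
      rw [← outcome_append, List.take_append_drop]
    simp only [List.mem_cons, List.not_mem_nil, or_false, forall_eq_or_imp, forall_eq, wires_cons,
      wires_nil] at hsw hzy
    simp only [foldBlocks, act_append, outcome_cons, outcome_append]
    rw [← hn_def, ← hy, ← hz, hsw.1, hsw.2, hBw, hzy.1, hzy.2.2.1, hy₁, hy₂, hL]
    change (if _ then (outcome (foldBlock As (L.take n)).2.1 z).or _ else _) = _ ∧ _
    rw [hB₁]
    -- The induction hypothesis is invoked only when both seed digits and the block are equal; in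
    -- the other cases `Option.or` or the seed digit hides the later rounds.
    cases hi : x i.1
    · simp
    cases hj : x j.1
    · simp
    cases hB : outcome (L.take n) x with
    | some v => simp
    | none =>
      obtain ⟨ih₁, ih₂⟩ := ih hnR z fun a ha => by
        simp only [List.mem_cons, List.flatten_append, List.mem_append, List.flatten_cons,
          List.flatten_nil, List.not_mem_nil, or_false] at ha
        rcases ha with rfl | ha | rfl
        · rw [hzy.2.2.2.1, hy₄, hj]; rfl
        · exact hB₂ hB a ha
        · rw [hzy.2.1, hy₃, hi]; rfl
      rw [hzR] at ih₁ ih₂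
      simpa using ⟨ih₁, ih₂⟩
  | case2 m As s L h =>
    rw [foldBlocks]
    · simpa using fun _ => hx s List.mem_cons_self
    · exact h

/-- Each further round starts five steps later and has one more level, which adds ten steps per
round; executed one after the other, the rounds would take quadratic time in `m`. -/
theorem release_foldBlocks (m : ℕ) (As : List (List Q)) (s : Q) (L : List (Q × Q))
    (hn : (s :: (As.flatten ++ wires L)).Nodup) (τ : Q → ℕ) (t : ℕ) (hA : Ready τ t As)
    (hL : ∀ a ∈ s :: wires L, τ a ≤ t) :
    ∀ a ∈ s :: (As.flatten ++ wires L),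
      release (foldBlocks m As s L).1 τ a ≤ t + 5 * (2 * m + As.length) := by
  induction m, As, s, L using foldBlocks.induct generalizing τ t with
  | case1 m As s i j L B ih =>
    set n := 2 ^ As.length with hn_def
    have hn' := nodup_of_count_le (count_foldBlock_append_le As s i j L n) hn
    rw [List.nodup_append, List.nodup_append] at hn'
    obtain ⟨-, ⟨-, hnR, hBR⟩, hsR⟩ := hn'
    rw [← List.cons_append] at hn
    obtain ⟨h₁, h₂, h₃⟩ := nodup_merge hn
    have hwL : wires L = wires (L.take n) ++ wires (L.drop n) := by
      rw [← wires_append, List.take_append_drop]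
    have h₄ : ((As.flatten ++ wires (L.take n)) ++ wires (L.drop n)).Nodup := by
      rwa [List.append_assoc, ← hwL]
    rw [List.nodup_append] at h₄
    obtain ⟨hnB, -, hBdrop⟩ := h₄
    have hmemB : ∀ a, a ∈ As.flatten ++ wires (L.take n) → a ∈ As.flatten ++ wires L :=
      fun a ha => by
        rw [hwL, ← List.append_assoc]
        exact List.mem_append_left _ ha
    have hs : SupportedOn (merge s i j) {a | a ∈ s :: wires [i, j]} :=
      supportedOn_merge (by simp) (by simp) (by simp) (by simp) (by simp)
    set σ := release (merge s i j) τ with hσ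
    have hσS : ∀ a ∈ s :: wires [i, j], σ a ≤ t + 5 := fun a ha =>
      (hs.release_le (fun p hp => hL p (by
        simp only [Set.mem_ofPred_eq, wires_cons, wires_nil, List.mem_cons, List.not_mem_nil,
          or_false] at hp ⊢
        tauto)) ha).trans (Nat.add_le_add_left (length_merge_le s i j) t)
    have hστ : ∀ a ∈ As.flatten ++ wires L, σ a = τ a := fun a ha =>
      hs.release_apply τ fun h => h₃ a h ha
    have hσL : ∀ a ∈ wires L, σ a ≤ t := fun a ha => by
      rw [hστ a (List.mem_append_right _ ha)]
      exact hL a (by simp [ha])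
    obtain ⟨hB₁, hB₂⟩ := release_foldBlock As (L.take n) hnB σ t
      (hA.congr fun a ha => hστ a (List.mem_append_left _ ha))
      fun a ha => hσL a (hwL ▸ List.mem_append_left _ ha)
    set ρ := release (foldBlock As (L.take n)).1 σ with hρ
    have hρσ : ∀ a, a ∉ As.flatten ++ wires (L.take n) → ρ a = σ a := fun a ha =>
      (supportedOn_foldBlock As (L.take n)).release_apply σ ha
    have hρS : ∀ a ∈ s :: wires [i, j], ρ a ≤ t + 5 := fun a ha => by
      rw [hρσ a fun h => h₃ a ha (hmemB a h)]
      exact hσS a ha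
    have hρR : ∀ a ∈ wires (L.drop n), ρ a ≤ t := fun a ha => by
      rw [hρσ a fun h => hBdrop a h a ha rfl]
      exact hσL a (hwL ▸ List.mem_append_right _ ha)
    have hlen : (B.2.2 ++ [[i.1]]).length = As.length + 1 := by
      rw [List.length_append, length_foldBlock_released, List.length_singleton]
    have hR := ih hnR ρ (t + 5) (hB₁.append_singleton (hρS _ (by simp))) fun a ha => by
      rcases List.mem_cons.1 ha with rfl | ha
      · exact hρS _ (by simp)
      · exact (hρR a ha).trans (Nat.le_add_right t 5)
    rw [hlen] at hR
    intro a ha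
    simp only [foldBlocks]
    rw [release_append, release_append, ← hn_def, ← hσ, ← hρ]
    change release (foldBlocks m (B.2.2 ++ [[i.1]]) j.1 (L.drop n)).1 ρ a ≤ _
    by_cases hb : a ∈ j.1 :: ((B.2.2 ++ [[i.1]]).flatten ++ wires (L.drop n))
    · exact (hR a hb).trans (by omega)
    · rw [(supportedOn_foldBlocks m _ _ _).release_apply _ hb]
      rw [← List.cons_append, (perm_merge s i j As.flatten L).mem_iff, List.mem_append, hwL,
        ← List.append_assoc, List.mem_append] at ha
      rcases ha with ha | ha | ha
      · exact (hρS a ha).trans (by omega)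
      · exact (hB₂ a ha).trans (by omega)
      · exact (hρR a ha).trans (by omega)
  | case2 m As s L h =>
    intro a ha
    rw [foldBlocks]
    · rw [release_nil]
      simp only [List.mem_cons, List.mem_append] at ha hL
      rcases ha with ha | ha | ha
      · exact (hL a (Or.inl ha)).trans (by omega)
      · exact (hA.le ha).trans (by omega)
      · exact (hL a (Or.inr ha)).trans (by omega)
    · exact h

/-- Computes the outcome of the comparison encoded in a list of digits, digit after digit, from the
least significant one on, starting with the value of the qubit `s`. Returns the circuit and the
qubit on which the outcome is computed. -/
def ladder : List (Q × Q) → Q → Circuit Q × Q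
  | [], s => ([], s)
  | i :: L, s =>
    ((ladder L s).1 ++ (cx i.2 (ladder L s).2 ++ ccx i.1 (ladder L s).2 i.2), i.2)

theorem ladder_mem (L : List (Q × Q)) (s : Q) : (ladder L s).2 ∈ s :: wires L := by
  cases L <;> simp [ladder]

theorem supportedOn_ladder (L : List (Q × Q)) (s : Q) :
    SupportedOn (ladder L s).1 {a | a ∈ s :: wires L} := by
  induction L with
  | nil => simp [ladder]
  | cons i L ih =>
    have hsub : {a | a ∈ s :: wires L} ⊆ {a | a ∈ s :: wires (i :: L)} := fun a ha => by
      simp only [Set.mem_ofPred_eq, wires_cons, List.mem_cons] at ha ⊢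
      tauto
    have h := hsub (ladder_mem L s)
    rw [ladder, supportedOn_append, supportedOn_append]
    exact ⟨ih.mono hsub, supportedOn_cx (by simp) h, supportedOn_ccx (by simp) h (by simp)⟩

theorem length_ladder_le (L : List (Q × Q)) (s : Q) : (ladder L s).1.length ≤ 2 * L.length := by
  induction L with
  | nil => simp [ladder]
  | cons i L ih =>
    have h₁ := length_cx_le i.2 (ladder L s).2
    have h₂ := length_ccx_le i.1 (ladder L s).2 i.2
    simp only [ladder, List.length_append, List.length_cons]
    omega

/-- Each step is the conditional copy used in `merge`: `i.2` takes over the outcome of the less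
significant digits if `i.1` is `1`. -/
theorem act_ladder (L : List (Q × Q)) (s : Q) (hn : (s :: wires L).Nodup) (x : Q → Bool) :
    act (ladder L s).1 x (ladder L s).2 = (outcome L x).getD (x s) := by
  induction L with
  | nil => simp [ladder]
  | cons i L ih =>
    simp only [wires_cons, List.nodup_cons, List.mem_cons, not_or] at hn
    obtain ⟨⟨hs₁, hs₂, hs⟩, ⟨h₁, hi₁⟩, hi₂, hL⟩ := hn
    have hl₁ : i.1 ∉ s :: wires L := by simpa using ⟨Ne.symm hs₁, hi₁⟩
    have hl₂ : i.2 ∉ s :: wires L := by simpa using ⟨Ne.symm hs₂, hi₂⟩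
    have hr₁ : i.1 ≠ (ladder L s).2 := fun h => hl₁ (h ▸ ladder_mem L s)
    have hr₂ : i.2 ≠ (ladder L s).2 := fun h => hl₂ (h ▸ ladder_mem L s)
    have hx₁ := (supportedOn_ladder L s).act_apply x hl₁
    have hx₂ := (supportedOn_ladder L s).act_apply x hl₂
    have ih := ih (List.nodup_cons.2 ⟨hs, hL⟩)
    simp only [ladder, act_append, act_cx hr₂, act_ccx hr₁ h₁ (Ne.symm hr₂), outcome_cons]
    simp only [Function.update_self, Function.update_of_ne hr₁, Function.update_of_ne hr₂, hx₁, hx₂,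
      ih]
    cases x i.1 <;> cases x i.2 <;> simp

end Circuit

/-! ### Adding the outcome to the target without ancillas. -/

namespace Circuit

variable {Q : Type*} [DecidableEq Q]

/-- Computes the outcome of the comparison encoded in `L` on some qubit, using a qubit `s` in state
`0`. Returns the circuit, which may change the other qubits of `L` too, and that qubit. -/
def reduce (m : ℕ) (s : Q) (L : List (Q × Q)) : Circuit Q × Q :=
  let R := foldBlocks m [] s L
  (R.1 ++ (ladder R.2.1 R.2.2).1, (ladder R.2.1 R.2.2).2)

theorem mem_of_mem_foldBlocks {m : ℕ} {s : Q} {L : List (Q × Q)} {a : Q}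
    (ha : a ∈ (foldBlocks m [] s L).2.2 :: wires (foldBlocks m [] s L).2.1) : a ∈ s :: wires L :=
  mem_of_count_le (count_foldBlocks_le m [] s L) ha

theorem reduce_mem (m : ℕ) (s : Q) (L : List (Q × Q)) : (reduce m s L).2 ∈ s :: wires L :=
  mem_of_mem_foldBlocks (ladder_mem _ _)

theorem supportedOn_reduce (m : ℕ) (s : Q) (L : List (Q × Q)) :
    SupportedOn (reduce m s L).1 {a | a ∈ s :: wires L} :=
  supportedOn_append.2 ⟨supportedOn_foldBlocks m [] s L,
    (supportedOn_ladder _ _).mono fun _ ha => mem_of_mem_foldBlocks ha⟩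

theorem length_reduce_le (m : ℕ) (s : Q) (L : List (Q × Q)) :
    (reduce m s L).1.length ≤ 5 * L.length := by
  have h₁ := length_foldBlocks m [] s L
  have h₂ := length_ladder_le (foldBlocks m [] s L).2.1 (foldBlocks m [] s L).2.2
  rw [reduce, List.length_append]
  omega

/-- The rounds take `10 * m` steps, and the ladder on at most `2 * m` digits takes `4 * m`. -/
theorem depthLE_reduce {m : ℕ} {s : Q} {L : List (Q × Q)} (hn : (s :: wires L).Nodup)
    (hm : L.length < 2 ^ m) : DepthLE (reduce m s L).1 (14 * m) := by
  have h₁ : DepthLE (foldBlocks m [] s L).1 (10 * m) := fun q => by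
    rw [finishTime_eq_release]
    by_cases hq : q ∈ s :: (List.flatten [] ++ wires L)
    · refine (release_foldBlocks m [] s L hn (fun _ => 0) 0 trivial (fun _ _ => le_rfl) q
        hq).trans ?_
      rw [List.length_nil]
      omega
    · rw [(supportedOn_foldBlocks m [] s L).release_apply _ hq]
      exact Nat.zero_le _
  have h₂ := foldBlocks_card m [] s L (fun _ => trivial) (by simpa using hm)
  have h₃ := length_ladder_le (foldBlocks m [] s L).2.1 (foldBlocks m [] s L).2.2
  exact fun q => (h₁.append (depthLE_length _) q).trans (by omega)

/-- If all digits are equal, the ladder starts from the last released qubit, which is then `0`: the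
right default value. -/
theorem act_reduce {m : ℕ} {s : Q} {L : List (Q × Q)} (hn : (s :: wires L).Nodup) {x : Q → Bool}
    (hx : x s = false) :
    act (reduce m s L).1 x (reduce m s L).2 = (outcome L x).getD false := by
  obtain ⟨h₁, h₂⟩ := outcome_foldBlocks m [] s L hn x (by simpa using hx)
  rw [reduce, act_append, act_ladder _ _ (nodup_of_count_le (count_foldBlocks_le m [] s L) hn), h₁]
  cases h : outcome L x with
  | some v => rfl
  | none => exact h₂ h

/-- Adds to `t` the value that the circuit `W` computes on `r`, and undoes `W`. -/
def toggle (W : Circuit Q) (r t : Q) : Circuit Q := W ++ (cx r t ++ W.reverse)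

theorem act_toggle {W : Circuit Q} {S : Set Q} (hW : SupportedOn W S) {r t : Q} (hr : r ∈ S)
    (ht : t ∉ S) (x : Q → Bool) :
    act (toggle W r t) x = Function.update x t (xor (x t) (act W x r)) := by
  have hrt : r ≠ t := fun h => ht (h ▸ hr)
  rw [toggle, act_append, act_append, act_cx hrt, (supportedOn_reverse.2 hW).act_update _ _ ht,
    act_reverse_act, hW.act_apply x ht]

theorem length_toggle_le (W : Circuit Q) (r t : Q) : (toggle W r t).length ≤ 2 * W.length + 1 := by
  have := length_cx_le r t
  simp only [toggle, List.length_append, List.length_reverse]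
  omega

theorem DepthLE.mono {C : Circuit Q} {c d : ℕ} (h : DepthLE C c) (hcd : c ≤ d) : DepthLE C d :=
  fun q => (h q).trans hcd

theorem depthLE_toggle {W : Circuit Q} {d : ℕ} (h : DepthLE W d) (r t : Q) :
    DepthLE (toggle W r t) (2 * d + 1) :=
  (h.append (((depthLE_length _).mono (length_cx_le r t)).append h.reverse)).mono (by omega)

/-- Adds the outcome of the comparison encoded in a list of digits to the qubit `z`. -/
def addOutcome (m : ℕ) (z : Q) : List (Q × Q) → Circuit Q
  | [] => []
  | i :: L =>
    let T := toggle (reduce m i.1 L).1 (reduce m i.1 L).2 i.2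
    [Gate.X i.1] ++ cx i.2 z ++ T ++ cx i.2 z ++ ccx i.1 i.2 z ++ T ++ [Gate.X i.1]

theorem length_addOutcome_le (m : ℕ) (z : Q) (L : List (Q × Q)) :
    (addOutcome m z L).length ≤ 20 * L.length + 7 := by
  cases L with
  | nil => simp [addOutcome]
  | cons i L =>
    have h₁ := length_toggle_le (reduce m i.1 L).1 (reduce m i.1 L).2 i.2
    have h₂ := length_reduce_le m i.1 L
    have h₃ := length_cx_le i.2 z
    have h₄ := length_ccx_le i.1 i.2 z
    simp only [addOutcome, List.length_append, List.length_cons, List.length_nil]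
    omega

theorem depthLE_addOutcome {m : ℕ} {z : Q} {L : List (Q × Q)} (hn : (z :: wires L).Nodup)
    (hm : L.length ≤ 2 ^ m) : DepthLE (addOutcome m z L) (56 * m + 7) := by
  cases L with
  | nil => exact fun q => Nat.zero_le _
  | cons i L =>
    have hn' : (i.1 :: wires L).Nodup := by
      simp only [wires_cons, List.nodup_cons, List.mem_cons, not_or] at hn ⊢
      exact ⟨hn.2.1.2, hn.2.2.2⟩
    have hT := depthLE_toggle (depthLE_reduce hn' hm) (reduce m i.1 L).2 i.2
    have h₃ := (depthLE_length (cx i.2 z)).mono (length_cx_le i.2 z)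
    have h₄ := (depthLE_length (ccx i.1 i.2 z)).mono (length_ccx_le i.1 i.2 z)
    have hX := depthLE_length [Gate.X i.1]
    refine ((((((hX.append h₃).append hT).append h₃).append h₄).append hT).append hX).mono ?_
    rw [List.length_singleton]
    omega

/-- Let `e`, `v` be the values of the top digit and `w` the result of `reduce`. The two `cx` around
the first toggle add `v` and `v ⊕ w`, hence `w`, to `z`; the `ccx` adds `¬e ∧ (v ⊕ w)`. The total is
`w` if `e = 1` and `v` otherwise. The second toggle restores `v`. -/
theorem act_addOutcome (m : ℕ) {z : Q} {L : List (Q × Q)} (hn : (z :: wires L).Nodup)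
    (x : Q → Bool) :
    act (addOutcome m z L) x = Function.update x z (xor (x z) ((outcome L x).getD false)) := by
  cases L with
  | nil => simp [addOutcome]
  | cons i L =>
    simp only [wires_cons, List.nodup_cons, List.mem_cons, not_or] at hn
    obtain ⟨⟨hz₁, hz₂, hz⟩, ⟨h₁, hi₁⟩, hi₂, hL⟩ := hn
    have hn' : (i.1 :: wires L).Nodup := List.nodup_cons.2 ⟨hi₁, hL⟩
    have hzS : z ∉ {a | a ∈ i.1 :: wires L} := by simpa using ⟨hz₁, hz⟩
    have hiS : i.2 ∉ {a | a ∈ i.1 :: wires L} := by simpa using ⟨Ne.symm h₁, hi₂⟩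
    have hS := supportedOn_reduce m i.1 L
    have hmem := reduce_mem m i.1 L
    have hrz : (reduce m i.1 L).2 ≠ z := fun h => hzS (h ▸ hmem)
    have hrb : (reduce m i.1 L).2 ≠ i.2 := fun h => hiS (h ▸ hmem)
    simp only [addOutcome, act_append, act_toggle hS hmem hiS, act_cx (Ne.symm hz₂),
      act_ccx h₁ (Ne.symm hz₁) (Ne.symm hz₂), act_cons, act_nil, Gate.act,
      hS.act_update _ _ hzS, hS.act_update _ _ hiS, Function.update_of_ne hrz,
      Function.update_of_ne hrb, outcome_cons]
    -- Only for equal top bits is the flipped flag a clean qubit; otherwise `w` is an arbitrary bit,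
    -- the same in both toggles, and it cancels.
    have hw : x i.1 = true →
        act (reduce m i.1 L).1 (Function.update x i.1 (!(x i.1))) (reduce m i.1 L).2 =
          (outcome L x).getD false := fun h => by
      rw [act_reduce hn' (by simp [h]), outcome_congr (y := x) fun a ha =>
        Function.update_of_ne (ne_of_mem_of_not_mem ha hi₁) _ _]
    generalize act (reduce m i.1 L).1 (Function.update x i.1 (!(x i.1))) (reduce m i.1 L).2 = w
      at hw ⊢
    funext a
    have hz₁' := Ne.symm hz₁
    have hz₂' := Ne.symm hz₂
    have h₁' := Ne.symm h₁
    by_cases ha₁ : a = z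
    · subst ha₁
      simp only [Function.update_apply, h₁, h₁', hz₁, hz₂, hz₁', hz₂', if_true, if_false]
      cases hx : x i.1
      · cases x a <;> cases x i.2 <;> cases w <;> rfl
      · rw [if_pos rfl, ← hw hx]
        cases x a <;> cases x i.2 <;> cases w <;> rfl
    · by_cases ha₂ : a = i.1
      · subst ha₂
        simp [Function.update_apply, h₁, hz₁']
      · by_cases ha₃ : a = i.2
        · subst ha₃
          simp [Function.update_apply, h₁', hz₂']
        · simp [Function.update_apply, ha₁, ha₂, ha₃]

/-- Replaces the first qubit of each pair by the truth value of the equality of the two. -/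
def prepare : List (Q × Q) → Circuit Q
  | [] => []
  | i :: L => (cx i.2 i.1 ++ [Gate.X i.1]) ++ prepare L

/-- The last bit of the first pair of different bits, if there is one. -/
def firstDifference : List (Q × Q) → (Q → Bool) → Option Bool
  | [], _ => none
  | i :: L, x => if x i.1 = x i.2 then firstDifference L x else some (x i.2)

theorem supportedOn_prepare (L : List (Q × Q)) :
    SupportedOn (prepare L) {a | a ∈ wires L} := by
  induction L with
  | nil => simp [prepare]
  | cons i L ih =>
    rw [prepare, supportedOn_append, supportedOn_append]
    exact ⟨⟨supportedOn_cx (by simp) (by simp), by simp [Gate.support]⟩, ih.mono fun a ha => by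
      simp only [Set.mem_ofPred_eq, wires_cons, List.mem_cons] at ha ⊢
      tauto⟩

theorem supportedOn_prepare_head (i : Q × Q) :
    SupportedOn (cx i.2 i.1 ++ [Gate.X i.1]) {a | a ∈ wires [i]} :=
  supportedOn_append.2 ⟨supportedOn_cx (by simp) (by simp), by simp [Gate.support]⟩

theorem length_prepare_le (L : List (Q × Q)) : (prepare L).length ≤ 2 * L.length := by
  induction L with
  | nil => simp [prepare]
  | cons i L ih =>
    have := length_cx_le i.2 i.1
    simp only [prepare, List.length_append, List.length_cons, List.length_nil]
    omega

/-- The pairs are disjoint, so the depth is that of the two gates of one pair. -/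
theorem depthLE_prepare {L : List (Q × Q)} (hn : (wires L).Nodup) : DepthLE (prepare L) 2 := by
  suffices h : ∀ τ : Q → ℕ, (∀ a ∈ wires L, τ a = 0) → ∀ a ∈ wires L, release (prepare L) τ a ≤ 2 by
    intro q
    rw [finishTime_eq_release]
    by_cases hq : q ∈ wires L
    · exact h _ (fun _ _ => rfl) q hq
    · rw [(supportedOn_prepare L).release_apply _ hq]
      exact Nat.zero_le _
  induction L with
  | nil => simp
  | cons i L ih =>
    simp only [wires_cons, List.nodup_cons, List.mem_cons, not_or] at hn
    intro τ hτ a ha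
    have hdis : ∀ p ∈ wires [i], p ∉ wires L := fun p hp => by
      simp only [wires_cons, wires_nil, List.mem_cons, List.not_mem_nil, or_false] at hp
      rcases hp with rfl | rfl
      exacts [hn.1.2, hn.2.1]
    rw [prepare, release_append]
    by_cases haL : a ∈ wires L
    · refine ih hn.2.2 _ (fun p hp => ?_) a haL
      rw [(supportedOn_prepare_head i).release_apply τ fun h => hdis p h hp]
      exact hτ p (by simp [hp])
    · have hai : a ∈ wires [i] := by
        simp only [wires_cons, wires_nil, List.mem_cons, List.not_mem_nil, or_false] at ha ⊢
        tauto
      rw [(supportedOn_prepare L).release_apply _ haL]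
      refine ((supportedOn_prepare_head i).release_le (t := 0) (fun p hp => ?_) hai).trans ?_
      · refine (hτ p ?_).le
        simp only [Set.mem_ofPred_eq, wires_cons, wires_nil, List.mem_cons, List.not_mem_nil,
          or_false] at hp ⊢
        tauto
      · have := length_cx_le i.2 i.1
        rw [List.length_append, List.length_singleton]
        omega

theorem outcome_prepare {L : List (Q × Q)} (hn : (wires L).Nodup) (x : Q → Bool) :
    outcome L (act (prepare L) x) = firstDifference L x := by
  have hcongr : ∀ (M : List (Q × Q)) (x y : Q → Bool), (∀ a ∈ wires M, x a = y a) →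
      firstDifference M x = firstDifference M y := fun M x y h => by
    induction M with
    | nil => rfl
    | cons i M ih =>
      simp only [wires_cons, List.mem_cons, forall_eq_or_imp] at h
      simp [firstDifference, h.1, h.2.1, ih h.2.2]
  induction L generalizing x with
  | nil => rfl
  | cons i L ih =>
    simp only [wires_cons, List.nodup_cons, List.mem_cons, not_or] at hn
    obtain ⟨⟨h₁, hi₁⟩, hi₂, hL⟩ := hn
    rw [prepare, act_append, outcome_cons, ih hL, (supportedOn_prepare L).act_apply _ hi₁,
      (supportedOn_prepare L).act_apply _ hi₂, firstDifference, hcongr L _ x fun a ha =>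
        (supportedOn_prepare_head i).act_apply x fun h => ?_]
    · simp only [act_append, act_cx (Ne.symm h₁), act_cons, act_nil, Gate.act,
        Function.update_self, Function.update_of_ne (Ne.symm h₁)]
      cases x i.1 <;> cases x i.2 <;> simp
    · simp only [Set.mem_ofPred_eq, wires_cons, wires_nil, List.mem_cons, List.not_mem_nil,
        or_false] at h
      rcases h with rfl | rfl
      exacts [hi₁ ha, hi₂ ha]

/-- Adds the last bit of the first pair of different bits to the qubit `z`. -/
def comparator (z : Q) (L : List (Q × Q)) : Circuit Q :=
  prepare L ++ (addOutcome (Nat.clog 2 L.length) z L ++ (prepare L).reverse)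

theorem length_comparator_le (z : Q) (L : List (Q × Q)) :
    (comparator z L).length ≤ 24 * L.length + 7 := by
  have h₁ := length_prepare_le L
  have h₂ := length_addOutcome_le (Nat.clog 2 L.length) z L
  simp only [comparator, List.length_append, List.length_reverse]
  omega

theorem depthLE_comparator {z : Q} {L : List (Q × Q)} (hn : (z :: wires L).Nodup) :
    DepthLE (comparator z L) (56 * Nat.clog 2 L.length + 11) :=
  have h := depthLE_prepare (List.nodup_cons.1 hn).2
  (h.append ((depthLE_addOutcome hn (Nat.le_pow_clog (by norm_num) _)).append h.reverse)).mono
    (by omega)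

theorem act_comparator {z : Q} {L : List (Q × Q)} (hn : (z :: wires L).Nodup) (x : Q → Bool) :
    act (comparator z L) x =
      Function.update x z (xor (x z) ((firstDifference L x).getD false)) := by
  obtain ⟨hz, hL⟩ := List.nodup_cons.1 hn
  rw [comparator, act_append, act_append, act_addOutcome _ hn, outcome_prepare hL,
    (supportedOn_reverse.2 (supportedOn_prepare L)).act_update _ _ hz, act_reverse_act,
    (supportedOn_prepare L).act_apply x hz]

end Circuit

/-! ### From lists of digits to binary numbers. -/

namespace Circuit

variable {Q : Type*}

/-- The list of the values of `f`, in decreasing order of the arguments. -/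
def digits {α : Type*} : (n : ℕ) → (Fin n → α) → List α
  | 0, _ => []
  | n + 1, f => f (Fin.last n) :: digits n (f ∘ Fin.castSucc)

theorem length_digits {α : Type*} (n : ℕ) (f : Fin n → α) : (digits n f).length = n := by
  induction n with
  | zero => rfl
  | succ n ih => simp [digits, ih]

theorem mem_wires_digits {n : ℕ} {f : Fin n → Q × Q} {a : Q} :
    a ∈ wires (digits n f) ↔ ∃ i, a = (f i).1 ∨ a = (f i).2 := by
  induction n with
  | zero => simp [digits]
  | succ n ih => simp only [digits, wires_cons, List.mem_cons, ih, Fin.exists_fin_succ',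
      Function.comp_apply, ← or_assoc, or_comm]

theorem nodup_wires_digits {n : ℕ} {f : Fin n → Q × Q}
    (h₁ : Function.Injective fun i => (f i).1) (h₂ : Function.Injective fun i => (f i).2)
    (h₁₂ : ∀ i j, (f i).1 ≠ (f j).2) : (wires (digits n f)).Nodup := by
  induction n with
  | zero => exact List.nodup_nil
  | succ n ih =>
    simp only [digits, wires_cons, List.nodup_cons, List.mem_cons, mem_wires_digits, not_or,
      not_exists, Function.comp_apply]
    refine ⟨⟨h₁₂ _ _, fun i => ⟨fun h => ?_, h₁₂ _ _⟩⟩, fun i => ⟨(h₁₂ _ _).symm, fun h => ?_⟩,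
      ih (h₁.comp (Fin.castSucc_injective n)) (h₂.comp (Fin.castSucc_injective n))
        fun i j => h₁₂ _ _⟩
    · exact Fin.castSucc_ne_last i (h₁ h).symm
    · exact Fin.castSucc_ne_last i (h₂ h).symm

theorem bitsValue_succ {n : ℕ} (a : Fin (n + 1) → Bool) :
    bitsValue a = bitsValue (a ∘ Fin.castSucc) + (a (Fin.last n)).toNat * 2 ^ n := by
  simp [bitsValue, Fin.sum_univ_castSucc]

theorem bitsValue_lt {n : ℕ} (a : Fin n → Bool) : bitsValue a < 2 ^ n := by
  induction n with
  | zero => simp [bitsValue]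
  | succ n ih =>
    have h := ih (a ∘ Fin.castSucc)
    rw [bitsValue_succ, pow_succ]
    cases a (Fin.last n) <;> simp <;> omega

/-- The lower bits contribute less than `2 ^ n`, so differing top bits decide the comparison, and
equal ones cancel. -/
theorem firstDifference_digits {n : ℕ} (f : Fin n → Q × Q) (x : Q → Bool) :
    (firstDifference (digits n f) x).getD false =
      decide (bitsValue (fun i => x (f i).1) < bitsValue fun i => x (f i).2) := by
  induction n with
  | zero => simp [digits, firstDifference, bitsValue]
  | succ n ih =>
    have h := ih (f ∘ Fin.castSucc)
    have h₁ := bitsValue_lt fun i => x ((f ∘ Fin.castSucc) i).1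
    have h₂ := bitsValue_lt fun i => x ((f ∘ Fin.castSucc) i).2
    rw [bitsValue_succ, bitsValue_succ]
    change _ = decide (bitsValue (fun i => x ((f ∘ Fin.castSucc) i).1) + _ <
      bitsValue (fun i => x ((f ∘ Fin.castSucc) i).2) + _)
    generalize bitsValue (fun i => x ((f ∘ Fin.castSucc) i).1) = u at *
    generalize bitsValue (fun i => x ((f ∘ Fin.castSucc) i).2) = v at *
    rw [digits, firstDifference]
    cases x (f (Fin.last n)).1 <;> cases x (f (Fin.last n)).2
    · simpa using h
    · simp; omega
    · simp; omega
    · simpa using h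

end Circuit

/-- The comparator circuit on two `n`-qubit registers and a target qubit. -/
def comparatorCircuit (n : ℕ) : Circuit (ComparatorQubit n) :=
  Circuit.comparator (Sum.inr (Sum.inr ()))
    (Circuit.digits n fun i => (Sum.inl i, Sum.inr (Sum.inl i)))

namespace comparatorCircuit

open Circuit

theorem nodup_qubits (n : ℕ) : ((Sum.inr (Sum.inr ()) : ComparatorQubit n) ::
    wires (digits n fun i => (Sum.inl i, Sum.inr (Sum.inl i)))).Nodup := by
  refine List.nodup_cons.2 ⟨by simp [mem_wires_digits], nodup_wires_digits ?_ ?_ ?_⟩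
  · exact Sum.inl_injective
  · exact Sum.inr_injective.comp Sum.inl_injective
  · simp

theorem act_eq (n : ℕ) (x : ComparatorQubit n → Bool) :
    act (comparatorCircuit n) x = Function.update x (Sum.inr (Sum.inr ()))
      (xor (x (Sum.inr (Sum.inr ()))) (decide (bitsValue (fun i => x (Sum.inl i)) <
        bitsValue fun i => x (Sum.inr (Sum.inl i))))) := by
  rw [comparatorCircuit, act_comparator (nodup_qubits n), firstDifference_digits]

theorem isComparator (n : ℕ) : IsComparator (unitary (comparatorCircuit n)) := by
  intro a b z
  rw [ket₃, unitary_ket, act_eq, ket₃]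
  congr 1
  funext q
  rcases q with i | i | u <;> simp
  rfl

theorem length_le (n : ℕ) : (comparatorCircuit n).length ≤ 24 * n + 7 := by
  simpa [length_digits, comparatorCircuit] using length_comparator_le (Sum.inr (Sum.inr ()))
    (digits n fun i => ((Sum.inl i, Sum.inr (Sum.inl i)) : ComparatorQubit n × ComparatorQubit n))

theorem depth_le (n : ℕ) : depth (comparatorCircuit n) ≤ 56 * Nat.clog 2 n + 11 := by
  simpa [length_digits, comparatorCircuit] using (depthLE_comparator (nodup_qubits n)).depth_le

end comparatorCircuit

/-! ### Lower bounds and asymptotics. -/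

/-- The target qubit of a circuit that acts as a comparator depends on all the qubits of the first
register. -/
theorem Circuit.le_of_act_eq {n : ℕ} {C : Circuit (ComparatorQubit n)}
    (hC : ∀ x, C.act x = Function.update x (Sum.inr (Sum.inr ()))
      (xor (x (Sum.inr (Sum.inr ()))) (decide (bitsValue (fun i => x (Sum.inl i)) <
        bitsValue fun i => x (Sum.inr (Sum.inl i)))))) :
    n ≤ 3 ^ C.depth ∧ n ≤ 3 * C.length + 1 := by
  obtain ⟨S, h₁, h₂, hS⟩ := C.exists_lightCone (Sum.inr (Sum.inr ()))
  suffices h : n ≤ S.card by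
    refine ⟨h.trans (h₁.trans (Nat.pow_le_pow_right (by norm_num) ?_)), h.trans h₂⟩
    exact Finset.le_sup (f := C.finishTime) (Finset.mem_univ _)
  have hmem : ∀ i : Fin n, Sum.inl i ∈ S := fun i => by
    by_contra hi
    -- With `b = 2 ^ i`, the inputs `a = 0` and `a = 2 ^ i` differ in one qubit only, yet `a < b`
    -- holds just for the first.
    have h := hS (Sum.elim (fun _ => false) (Sum.elim (fun j => decide (j = i)) fun _ => false))
      (Sum.elim (fun j => decide (j = i)) (Sum.elim (fun j => decide (j = i)) fun _ => false))
      fun p hp => by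
        rcases p with j | p
        · have : j ≠ i := fun h => hi (h ▸ hp)
          simp [this]
        · rfl
    rw [hC, hC] at h
    have hpos : 0 < bitsValue fun j => decide (j = i) :=
      Finset.sum_pos' (fun _ _ => Nat.zero_le _) ⟨i, Finset.mem_univ i, by simp⟩
    have hzero : bitsValue (fun _ : Fin n => false) = 0 := by simp [bitsValue]
    simp [hzero, hpos.ne'] at h
  calc n = (Finset.univ.map (⟨Sum.inl, Sum.inl_injective⟩ : Fin n ↪ ComparatorQubit n)).card := by
        simp
    _ ≤ S.card := Finset.card_le_card fun q hq => by
        obtain ⟨i, -, rfl⟩ := Finset.mem_map.1 hq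
        exact hmem i

theorem Nat.clog_two_le_log {n : ℕ} (hn : 2 ≤ n) :
    (Nat.clog 2 n : ℝ) ≤ Real.log n / Real.log 2 + 1 := by
  have h : 0 ≤ Real.logb 2 n := Real.logb_nonneg (by norm_num) (by exact_mod_cast (by omega : 1 ≤ n))
  have := Nat.ceil_lt_add_one h
  rw [show (2 : ℝ) = ((2 : ℕ) : ℝ) by norm_num, Real.natCeil_logb_natCast, Real.logb] at this
  exact_mod_cast this.le

theorem theorem2 :
    ∃ C : (n : ℕ) → Circuit (ComparatorQubit n),
      (∀ n, IsComparator (Circuit.unitary (C n))) ∧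
      (fun n : ℕ => (Circuit.gateCount (C n) : ℝ)) =Θ[Filter.atTop] (fun n : ℕ => (n : ℝ)) ∧
      (fun n : ℕ => (Circuit.depth (C n) : ℝ)) =Θ[Filter.atTop]
        (fun n : ℕ => Real.log (n : ℝ)) := by
  refine ⟨comparatorCircuit, comparatorCircuit.isComparator, ⟨?_, ?_⟩, ⟨?_, ?_⟩⟩
  -- `24 * n + 7 ≤ 31 * n` for `n ≥ 1`.
  · refine Asymptotics.IsBigO.of_bound 31 (Filter.eventually_atTop.2 ⟨1, fun n hn => ?_⟩)
    rw [Real.norm_natCast, Real.norm_natCast]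
    have := comparatorCircuit.length_le n
    exact_mod_cast (by rw [Circuit.gateCount]; omega :
      Circuit.gateCount (comparatorCircuit n) ≤ 31 * n)
  -- For `n ≥ 2`, `n ≤ 3 * g + 1` forces `g ≥ 1`, whence `n ≤ 6 * g`.
  · refine Asymptotics.IsBigO.of_bound 6 (Filter.eventually_atTop.2 ⟨2, fun n hn => ?_⟩)
    rw [Real.norm_natCast, Real.norm_natCast]
    have := (Circuit.le_of_act_eq (comparatorCircuit.act_eq n)).2
    exact_mod_cast (by rw [Circuit.gateCount]; omega :
      n ≤ 6 * Circuit.gateCount (comparatorCircuit n))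
  -- With `x = log n / log 2 ≥ 1`, `56 * (x + 1) + 11 ≤ 123 * x`.
  · refine Asymptotics.IsBigO.of_bound (123 / Real.log 2)
      (Filter.eventually_atTop.2 ⟨2, fun n hn => ?_⟩)
    have h2 : 0 < Real.log 2 := Real.log_pos (by norm_num)
    have hlog : Real.log 2 ≤ Real.log n := Real.log_le_log (by norm_num) (by exact_mod_cast hn)
    rw [Real.norm_natCast, Real.norm_of_nonneg (h2.le.trans hlog)]
    have h₁ : (Circuit.depth (comparatorCircuit n) : ℝ) ≤ 56 * Nat.clog 2 n + 11 := by
      exact_mod_cast comparatorCircuit.depth_le n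
    have h₂ := Nat.clog_two_le_log hn
    have h₃ : 1 ≤ Real.log n / Real.log 2 := (one_le_div h2).2 hlog
    rw [div_mul_eq_mul_div, mul_div_assoc]
    linarith
  · refine Asymptotics.IsBigO.of_bound (Real.log 3)
      (Filter.eventually_atTop.2 ⟨1, fun n hn => ?_⟩)
    have hn' : (1 : ℝ) ≤ n := by exact_mod_cast hn
    rw [Real.norm_natCast, Real.norm_of_nonneg (Real.log_nonneg hn'), mul_comm, ← Real.log_pow]
    refine Real.log_le_log (by linarith) ?_
    exact_mod_cast (Circuit.le_of_act_eq (comparatorCircuit.act_eq n)).1
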